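/- For a sequence $(K_n)_{n\in\omega}$ of subsets of a topological space $X$ let $\mathrm{Li}\,(K_n)$ (respectively $\mathrm{Ls}\,(K_n)$) be the set of all $x\in X$ such that every neighborhood of $x$ meets $K_n$ for all but finitely many $n$ (respectively for infinitely many $n$); the sequence converges if $\mathrm{Li}\,(K_n)=\mathrm{Ls}\,(K_n)$. Write $X\in\mathrm{GBW}$ if every sequence of subsets of $X$ has a convergent subsequence. Let $\mathfrak s$ be the splitting number, i.e. the least size of a family $\mathcal S$ of infinite subsets of $\omega$ such that for every infinite $A\subseteq\omega$ there is $S\in\mathcal S$ with $A\cap S$ and $A\setminus S$ both infinite. Call $X$ a *Fedorčuk space* if it is an infinite, compact Hausdorff, hereditarily separable space in which every convergent sequence is eventually equal to its limit. Then: 1. Every countably compact space $X\in\mathrm{GBW}$ is sequentially compact. 2. If $X$ is a Fedorčuk space, then $X$ is not sequentially compact and $X\notin\mathrm{GBW}$, while every discrete subspace of $X$ is countable. 3. Assume Jensen's principle $\diamondsuit$: there are sets $A_\alpha\subseteq\alpha$ ($\alpha<\omega_1$) such that for every $S\subseteq\omega_1$ the set $\{\alpha<\omega_1 : S\cap\alpha=A_\alpha\}$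 is stationary in $\omega_1$. Then there exists a Fedorčuk space, which by 2 is not in $\mathrm{GBW}$. Consequently, under $\diamondsuit$, the converse of the theorem "if $X$ has a discrete subspace of size at least $\mathfrak s$, then $X\notin\mathrm{GBW}$" fails: not every space $X\notin\mathrm{GBW}$ has a discrete subspace $D$ with $|D|\geq\mathfrak s$. -/

import Mathlib

open Set Filter Topology

universe u

namespace GBWSpace

section Kuratowski

variable {X : Type u} [TopologicalSpace X]

/-- The lower closed limit: the points all of whose neighbourhoods meet all but finitely many of
the sets `K n`. -/
def lowerLimit (K : ℕ → Set X) : Set X :=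
  {x | ∀ U ∈ 𝓝 x, ∀ᶠ n in atTop, (U ∩ K n).Nonempty}

/-- The upper closed limit: the points all of whose neighbourhoods meet infinitely many of the
sets `K n`. -/
def upperLimit (K : ℕ → Set X) : Set X :=
  {x | ∀ U ∈ 𝓝 x, ∃ᶠ n in atTop, (U ∩ K n).Nonempty}

/-- Kuratowski convergence of a sequence of sets. -/
def KuratowskiConverges (K : ℕ → Set X) : Prop :=
  lowerLimit K = upperLimit K

end Kuratowski

/-- The generalized Bolzano-Weierstrass property: every sequence of subsets has a subsequence that
converges in the sense of Kuratowski. -/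
def GBW (X : Type u) [TopologicalSpace X] : Prop :=
  ∀ K : ℕ → Set X, ∃ φ : ℕ → ℕ, StrictMono φ ∧ KuratowskiConverges (K ∘ φ)

/-- Every subspace is separable. -/
def HereditarilySeparable (X : Type u) [TopologicalSpace X] : Prop :=
  ∀ Y : Set X, TopologicalSpace.SeparableSpace Y

/-- There are no nontrivial convergent sequences: every convergent sequence is eventually equal
to its limit. (Used for Hausdorff spaces, where this says the same as that no sequence of pairwise
distinct points converges.) -/
def NoNontrivialConvergentSeq (X : Type u) [TopologicalSpace X] : Prop :=
  ∀ (s : ℕ → X) (x : X), Tendsto s atTop (𝓝 x) → ∀ᶠ n in atTop, s n = x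

/-- The properties of Fedorchuk's space: an infinite, compact Hausdorff, hereditarily separable
space without nontrivial convergent sequences. -/
structure IsFedorchukSpace (X : Type u) [TopologicalSpace X] : Prop where
  infinite : Infinite X
  compact : CompactSpace X
  hausdorff : T2Space X
  hereditarilySeparable : HereditarilySeparable X
  noConvergentSeq : NoNontrivialConvergentSeq X

/-- A splitting family of infinite subsets of `ℕ`. -/
def IsSplittingFamily (S : Set (Set ℕ)) : Prop :=
  (∀ s ∈ S, s.Infinite) ∧
    ∀ A : Set ℕ, A.Infinite → ∃ s ∈ S, (A ∩ s).Infinite ∧ (A \ s).Infinite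

/-- The splitting number: the least cardinality of a splitting family. -/
noncomputable def splittingNumber : Cardinal.{0} :=
  sInf {κ | ∃ S : Set (Set ℕ), IsSplittingFamily S ∧ Cardinal.mk S = κ}

/-- The set of countable ordinals, that is, the ordinal `ω₁`. -/
abbrev Omega1 : Type 1 := Set.Iio (Ordinal.omega.{0} 1)

/-- Jensen's principle `◇`: there are sets `A α ⊆ α`, for `α < ω₁`, such that for every
`S ⊆ ω₁` the set of those `α` with `S ∩ α = A α` is stationary in `ω₁`. -/
def Diamond : Prop :=
  ∃ A : Omega1 → Set Omega1, (∀ α, A α ⊆ Set.Iio α) ∧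
    ∀ S : Set Omega1, IsStationary {α | S ∩ Set.Iio α = A α}

end GBWSpace

/-!
A countably compact space with the property `GBW` is sequentially compact: if the singletons of a
sequence converge in the sense of Kuratowski, then a cluster point of the sequence is its limit. So
a Fedorchuk space, which is countably compact but has no convergent sequence of distinct points, is
not in `GBW`, while its discrete subspaces, being separable, are countable and hence smaller than
the splitting number. It remains to derive the existence of such a space from diamond.

The space is the limit of an inverse system of closed subsets of `2 ^ α`, `α < ω₁`, in which the
step from `α` to `α + 1` doubles a single point `p` and no other. All of it takes place in
`I → Bool` with `I` of order type `ω₁`, "modulo `α`" meaning that only coordinates below `α` are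
looked at. Enumerate the coordinates below `α`, let the depth of `x ≠ p` be the least index of a
coordinate at which `x` and `p` differ, and choose a colouring `c : ℕ → Bool`. A point `x` other
than `p` modulo `α` has the single extension `x α = c (depth x)`, and `p` has two extensions. A
sequence converging to `p` is split by the coordinate `α` if depths of both colours occur in it
infinitely often.

Diamond is used to guess, modulo `α`, initial segments of length `α` of sequences of points of
length `ω₁`. The colourings are chosen so that the following is preserved for every `α`: if `y` is
an accumulation point modulo `α` of the points guessed at `α`, then at every later stage each
neighbourhood of each point above `y` contains a whole fibre over one of the guessed points
(`fibresAccumulate_stage`). Only the steps that double a point matter. There, countably many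
requirements have to be met for both colours, each of them about a bounded interval of depths, and
these intervals can be placed arbitrarily far out; so a colouring that meets all of them exists
(`exists_coloring`, `exists_goodSplit`).

Consequently the limit is hereditarily separable. Otherwise it has a left-separated sequence
`x : I → X`. At a suitable `α` at which the sequence is guessed, `x α` is an accumulation point
modulo `α` of the earlier members (`exists_closure_function`), so that by the invariant it belongs
to their closure, a contradiction. A convergent sequence that is not eventually constant is guessed
as well, at some `α` at which its limit is the only accumulation point modulo `α`. If possible, the
point doubled at `α` is chosen to be such an accumulation point; so it is the limit, and the
coordinate `α` takes both values infinitely often along the sequence.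
-/

namespace GBWSpace

/-! ### Sequential compactness and the generalized Bolzano-Weierstrass property -/

/-- Apply the property `GBW` to the singletons of a sequence: a cluster point of the subsequence
lies in the upper limit, hence in the lower limit, which makes it a limit point. -/
theorem GBW.seqCompactSpace {X : Type u} [TopologicalSpace X] [CountablyCompactSpace X]
    (h : GBW X) : SeqCompactSpace X := by
  refine ⟨fun x _ => ?_⟩
  obtain ⟨φ, hφ, hK⟩ := h fun n => {x n}
  obtain ⟨a, -, ha⟩ := isCountablyCompact_iff_seq_clusterPt.1
    (CountablyCompactSpace.isCountablyCompact_univ (E := X)) (x ∘ φ)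
    (Eventually.of_forall fun _ => mem_univ _)
  refine ⟨a, mem_univ _, φ, hφ, ?_⟩
  have hup : a ∈ upperLimit ((fun n => ({x n} : Set X)) ∘ φ) := fun U hU =>
    (ha.frequently hU).mono fun n hn => ⟨_, hn, rfl⟩
  rw [← hK] at hup
  intro U hU
  refine (hup U hU).mono ?_
  rintro n ⟨y, hyU, rfl⟩
  exact hyU

theorem HereditarilySeparable.countable_of_isDiscrete {X : Type u} [TopologicalSpace X]
    (h : HereditarilySeparable X) {D : Set X} (hD : IsDiscrete D) : D.Countable := by
  have := isDiscrete_iff_discreteTopology.1 hD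
  exact countable_coe_iff.1 (TopologicalSpace.separableSpace_iff_countable.1 (h D))

theorem IsFedorchukSpace.not_seqCompactSpace {X : Type u} [TopologicalSpace X]
    (h : IsFedorchukSpace X) : ¬ SeqCompactSpace X := by
  intro hX
  have := h.infinite
  obtain ⟨a, φ, hφ, ha⟩ := SeqCompactSpace.tendsto_subseq (Infinite.natEmbedding X)
  obtain ⟨N, hN⟩ := eventually_atTop.1 (h.noConvergentSeq _ a ha)
  have h1 := (hN N le_rfl).trans (hN (N + 1) N.le_succ).symm
  exact (hφ N.lt_succ_self).ne ((Infinite.natEmbedding X).injective h1)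

theorem IsFedorchukSpace.not_GBW {X : Type u} [TopologicalSpace X]
    (h : IsFedorchukSpace X) : ¬ GBW X := fun hX =>
  have := h.compact
  h.not_seqCompactSpace hX.seqCompactSpace

/-! ### The splitting number is uncountable -/

/-- Sequential compactness of `ℕ → Prop` yields, for countably many sets, a subsequence of `ℕ`
which each of them eventually contains or eventually avoids. -/
theorem IsSplittingFamily.not_countable {S : Set (Set ℕ)} (hS : IsSplittingFamily S) :
    ¬ S.Countable := by
  intro hc
  have hne : S.Nonempty := (hS.2 univ infinite_univ).imp fun _ h => h.1
  obtain ⟨s, rfl⟩ := hc.exists_eq_range hne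
  classical
  obtain ⟨a, φ, hφ, ha⟩ := SeqCompactSpace.tendsto_subseq
    (fun (n : ℕ) (k : ℕ) => decide (n ∈ s k))
  obtain ⟨_, ⟨k, rfl⟩, h1, h2⟩ := hS.2 (range φ) (infinite_range_of_injective hφ.injective)
  obtain ⟨N, hN⟩ := eventually_atTop.1
    (tendsto_pure.1 (nhds_discrete Bool ▸ tendsto_pi_nhds.1 ha k))
  have hfin : (φ '' Iio N).Finite := (finite_Iio N).image φ
  obtain ⟨_, ⟨⟨n, rfl⟩, hn⟩, hnN⟩ := h1.exists_notMem_finite hfin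
  obtain ⟨_, ⟨⟨m, rfl⟩, hm⟩, hmN⟩ := h2.exists_notMem_finite hfin
  have hnN' : N ≤ n := not_lt.1 fun h => hnN (mem_image_of_mem _ h)
  have hmN' : N ≤ m := not_lt.1 fun h => hmN (mem_image_of_mem _ h)
  have h3 := (hN n hnN').trans (hN m hmN').symm
  simp only [Function.comp_apply, decide_eq_decide] at h3
  exact hm (h3.1 hn)

theorem aleph0_lt_splittingNumber : Cardinal.aleph0 < splittingNumber := by
  have hne : {κ | ∃ S : Set (Set ℕ), IsSplittingFamily S ∧ Cardinal.mk S = κ}.Nonempty := by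
    refine ⟨_, {s | s.Infinite}, ⟨fun s hs => hs, fun A hA => ?_⟩, rfl⟩
    have := hA.to_subtype
    obtain ⟨f⟩ : Nonempty (ℕ ↪ A) := ⟨Infinite.natEmbedding A⟩
    have hinj : Function.Injective fun n => (f n : ℕ) := fun m n h => f.injective (Subtype.ext h)
    -- the even-indexed members of `A` split `A`
    have heven : (range fun n => (f (2 * n) : ℕ)).Infinite :=
      infinite_range_of_injective fun m n h => by have := hinj h; omega
    have hodd : (range fun n => (f (2 * n + 1) : ℕ)).Infinite :=
      infinite_range_of_injective fun m n h => by have := hinj h; omega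
    refine ⟨_, heven, heven.mono ?_, hodd.mono ?_⟩
    · rintro _ ⟨n, rfl⟩
      exact ⟨(f _).2, n, rfl⟩
    · rintro _ ⟨n, rfl⟩
      refine ⟨(f _).2, ?_⟩
      rintro ⟨m, hm⟩
      have := hinj hm
      omega
  obtain ⟨S, hS, hSc⟩ := csInf_mem hne
  rw [splittingNumber, ← hSc]
  exact lt_of_not_ge fun h => hS.not_countable (Cardinal.le_aleph0_iff_set_countable.1 h)

/-! ### Guessing binary functions on the countable ordinals -/

section Order

variable {I : Type*} [LinearOrder I]

theorem exists_strictUpperBound_of_countable [Uncountable I] (hI : ∀ a : I, (Iic a).Countable)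
    {s : Set I} (hs : s.Countable) : ∃ a, ∀ b ∈ s, b < a := by
  by_contra! h
  refine not_countable_univ (α := I) ((hs.biUnion fun b _ => hI b).mono fun a _ => ?_)
  obtain ⟨b, hb, hab⟩ := h a
  exact mem_biUnion hb hab

theorem isClub_closurePoints [WellFoundedLT I] [Uncountable I] (hI : ∀ a : I, (Iic a).Countable)
    (g : I → I) (a₀ : I) : IsClub {a | a₀ < a ∧ ∀ b < a, g b < a} := by
  refine ⟨fun d hd hne _ a ha => ?_, fun a₁ => ?_⟩
  · obtain ⟨x, hx⟩ := hne
    refine ⟨(hd hx).1.trans_le (ha.1 hx), fun b hb => ?_⟩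
    obtain ⟨y, hy, hby⟩ := (lt_isLUB_iff ha).1 hb
    exact ((hd hy).2 b hby).trans_le (ha.1 hy)
  · have hstep : ∀ a : I, ∃ a', a < a' ∧ ∀ b ≤ a, g b < a' := fun a => by
      obtain ⟨a', h⟩ := exists_strictUpperBound_of_countable hI
        (((hI a).image g).union (countable_singleton a))
      exact ⟨a', h a (Or.inr rfl), fun b hb => h _ (Or.inl (mem_image_of_mem g hb))⟩
    choose next hnext hg using hstep
    let c : ℕ → I := fun n => next^[n] (max a₀ a₁)
    have hc : ∀ n, c (n + 1) = next (c n) := fun n => Function.iterate_succ_apply' _ _ _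
    obtain ⟨t, ht⟩ := exists_strictUpperBound_of_countable hI (countable_range c)
    obtain ⟨a, ha, hmin⟩ := WellFounded.has_min (wellFounded_lt (α := I)) {a | ∀ n, c n < a}
      ⟨t, fun n => ht _ ⟨n, rfl⟩⟩
    refine ⟨a, ⟨(le_max_left _ _).trans_lt (ha 0), fun b hb => ?_⟩,
      ((le_max_right _ _).trans_lt (ha 0)).le⟩
    obtain ⟨n, hn⟩ : ∃ n, b ≤ c n := by
      by_contra! h
      exact hmin b h hb
    exact (hg _ b hn).trans ((hc n).symm ▸ ha (n + 1))

/-- The sequence `B` guesses binary functions: for every `f : I → I → Bool` there are, beyond any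
`a₀` and among the ordinals closed under any given `g`, some `α` such that `B α` agrees with `f`
below `α`. -/
def Guesses (B : I → I → I → Bool) : Prop :=
  ∀ (f : I → I → Bool) (g : I → I) (a₀ : I), ∃ α, a₀ < α ∧ (∀ β < α, g β < α) ∧
    ∀ ξ < α, ∀ η < α, B α ξ η = f ξ η

end Order

instance : Uncountable Omega1 := by
  rw [← Cardinal.aleph0_lt_mk_iff]
  simp [Omega1]

theorem countable_Iic_omega1 (a : Omega1) : (Iic a).Countable := by
  have h : (Iio a.1).Countable := by
    have ha : a.1 < (Cardinal.aleph 1).ord := (Cardinal.ord_aleph 1).symm ▸ a.2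
    rw [Cardinal.lt_ord, ← Cardinal.succ_aleph0, Order.lt_succ_iff] at ha
    rw [← Cardinal.le_aleph0_iff_set_countable, Cardinal.mk_Iio_ordinal, Cardinal.lift_le_aleph0]
    exact ha
  have h' : (Iic a.1).Countable := by
    rw [← Iio_insert]
    exact h.insert _
  exact (h'.preimage Subtype.val_injective).mono fun b hb => hb

/-- Binary functions are coded as sets of countable ordinals by an injection of the pairs into
`ω₁`, whose closure points form a club. -/
theorem Diamond.exists_guesses (h : Diamond) : ∃ B : Omega1 → Omega1 → Omega1 → Bool,
    Guesses B := by
  classical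
  obtain ⟨A, -, hA⟩ := h
  obtain ⟨code⟩ : Nonempty (Omega1 × Omega1 ↪ Omega1) := by
    rw [← Cardinal.le_def, Cardinal.mk_prod, Cardinal.lift_id,
      Cardinal.mul_eq_self (Cardinal.aleph0_lt_mk).le]
  refine ⟨fun α ξ η => decide (code (ξ, η) ∈ A α), fun f g a₀ => ?_⟩
  have hb : ∀ β : Omega1, ∃ γ, g β < γ ∧ ∀ ξ ≤ β, ∀ η ≤ β, code (ξ, η) < γ := fun β => by
    obtain ⟨γ, hγ⟩ := exists_strictUpperBound_of_countable countable_Iic_omega1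
      ((((countable_Iic_omega1 β).prod (countable_Iic_omega1 β)).image code).union
        (countable_singleton (g β)))
    exact ⟨γ, hγ _ (Or.inr rfl), fun ξ hξ η hη => hγ _ (Or.inl ⟨(ξ, η), ⟨hξ, hη⟩, rfl⟩)⟩
  choose k hgk hck using hb
  obtain ⟨α, hα, hα₀, hαk⟩ := hA (code '' {p | f p.1 p.2 = true})
    (isClub_closurePoints countable_Iic_omega1 k a₀)
  refine ⟨α, hα₀, fun β hβ => (hgk β).trans (hαk β hβ), fun ξ hξ η hη => ?_⟩
  have hlt : code (ξ, η) < α :=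
    (hck (max ξ η) ξ (le_max_left _ _) η (le_max_right _ _)).trans (hαk _ (max_lt hξ hη))
  have hiff : code (ξ, η) ∈ A α ↔ f ξ η = true := by
    rw [← hα]
    simp [hlt]
  rw [Bool.eq_iff_iff, decide_eq_true_iff, hiff]

/-! ### A colouring lemma -/

/-- Given countably many tasks `t`, each of which is accomplished on suitable intervals `[n, m)`
that start at any prescribed `n`, there is a colouring of `ℕ` with two colours for which each task
is accomplished arbitrarily far out on intervals of either colour. -/
theorem exists_coloring {T : Type*} [Countable T] (P : T → ℕ → ℕ → Prop)
    (hmono : ∀ t n m m', m ≤ m' → P t n m → P t n m') (hP : ∀ t n, ∃ m, P t n m) :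
    ∃ c : ℕ → Bool, ∀ t n i, ∃ a ≥ n, ∃ b, P t a b ∧ ∀ m, a ≤ m → m < b → c m = i := by
  rcases isEmpty_or_nonempty T with hT | hT
  · exact ⟨fun _ => false, fun t => hT.elim t⟩
  obtain ⟨u, hu⟩ := exists_surjective_nat (T × Bool)
  choose μ hμ using hP
  -- the `j`-th interval `[N j, N (j + 1))` is devoted to the task and the colour `v j`,
  -- and each pair occurs as `v j` for arbitrarily large `j`
  let v : ℕ → T × Bool := fun j => u j.unpair.1
  let N : ℕ → ℕ := fun j => Nat.rec 0 (fun j n => max (μ (v j).1 n) (n + 1)) j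
  have hN : ∀ j, N (j + 1) = max (μ (v j).1 (N j)) (N j + 1) := fun j => rfl
  have hNm : StrictMono N := strictMono_nat_of_lt_succ fun j => by
    rw [hN]; exact Nat.lt_of_lt_of_le (N j).lt_succ_self (le_max_right _ _)
  have hex : ∀ m, ∃ j, m < N (j + 1) := fun m =>
    ⟨m, (hNm.le_apply (x := m)).trans_lt (hNm m.lt_succ_self)⟩
  refine ⟨fun m => (v (Nat.find (hex m))).2, fun t n i => ?_⟩
  obtain ⟨k, hk⟩ := hu (t, i)
  let j := Nat.pair k n
  have hvj : v j = (t, i) := by simp [v, j, hk]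
  refine ⟨N j, (Nat.right_le_pair k n).trans hNm.le_apply, N (j + 1), ?_, fun m h1 h2 => ?_⟩
  · refine hmono _ _ _ _ ?_ (hμ t (N j))
    rw [hN, hvj]
    exact le_max_left _ _
  · have hfind : Nat.find (hex m) = j := by
      refine le_antisymm (Nat.find_min' _ h2) (not_lt.1 fun hlt => ?_)
      exact (Nat.find_spec (hex m)).not_ge ((hNm.monotone hlt).trans h1)
    simp only [hfind, hvj]

/-! ### Splitting one point at a stage -/

theorem eventually_eqOn_finset {I : Type*} {x : I → Bool} (F : Finset I) :
    ∀ᶠ y in 𝓝 x, EqOn y x F :=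
  (Finset.eventually_all F).2 fun η _ =>
    tendsto_pure.1 (nhds_discrete Bool ▸ (continuous_apply η).tendsto x)

section Construction

variable {I : Type*} [LinearOrder I]

/-- For `x` which differs from `p` below `γ`, the least index, in the enumeration `e` of the
coordinates below `γ`, of a coordinate at which `x` and `p` differ; the junk value is `0`. It
measures how close `x` is to `p` modulo `γ`. -/
noncomputable def depth (e : I → ℕ) (γ : I) (p x : I → Bool) : ℕ :=
  sInf (e '' {η | η < γ ∧ x η ≠ p η})

/-- The restriction on the coordinate `γ` of a point `x` imposed by the splitting datum
`v = (p, c)` at stage `γ`: a point other than `p` modulo `γ` gets the colour of its depth, whereas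
`p` has two extensions. -/
def Admissible (e : I → ℕ) (γ : I) (v : (I → Bool) × (ℕ → Bool)) (x : I → Bool) : Prop :=
  EqOn x v.1 (Iio γ) ∨ x γ = v.2 (depth e γ v.1 x)

theorem depth_le {e : I → ℕ} {γ η : I} {p x : I → Bool} (hη : η < γ) (h : x η ≠ p η) :
    depth e γ p x ≤ e η :=
  Nat.sInf_le ⟨η, ⟨hη, h⟩, rfl⟩

theorem exists_eq_depth {e : I → ℕ} {γ : I} {p x : I → Bool} (h : ¬ EqOn x p (Iio γ)) :
    ∃ η < γ, x η ≠ p η ∧ e η = depth e γ p x := by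
  have hne : (e '' {η | η < γ ∧ x η ≠ p η}).Nonempty := by
    simp only [EqOn, not_forall] at h
    obtain ⟨η, h1, h2⟩ := h
    exact ⟨e η, η, ⟨h1, h2⟩, rfl⟩
  obtain ⟨η, ⟨h1, h2⟩, h3⟩ := Nat.sInf_mem hne
  exact ⟨η, h1, h2, h3⟩

theorem depth_congr {e : I → ℕ} {γ : I} {p x y : I → Bool} (h : EqOn x y (Iio γ)) :
    depth e γ p x = depth e γ p y := by
  have : {η | η < γ ∧ x η ≠ p η} = {η | η < γ ∧ y η ≠ p η} := by
    ext η
    exact and_congr_right fun hη => by rw [h hη]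
  rw [depth, depth, this]

theorem finite_index_le {e : I → ℕ} {γ : I} (he : InjOn e (Iio γ)) (n : ℕ) :
    {η | η < γ ∧ e η ≤ n}.Finite :=
  Finite.of_finite_image ((finite_Iic n).subset (by rintro _ ⟨η, h, rfl⟩; exact h.2))
    (he.mono fun _ h => h.1)

/-- Away from `p`, the depth is locally constant. -/
theorem exists_finset_depth_eq {e : I → ℕ} {γ : I} (he : InjOn e (Iio γ)) {p x : I → Bool}
    (h : ¬ EqOn x p (Iio γ)) : ∃ F : Finset I, (F : Set I) ⊆ Iio γ ∧
      ∀ y, EqOn y x F → ¬ EqOn y p (Iio γ) ∧ depth e γ p y = depth e γ p x := by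
  obtain ⟨η, hη, hne, heη⟩ := exists_eq_depth (e := e) h
  refine ⟨(finite_index_le he (depth e γ p x)).toFinset, fun ζ hζ => by simp_all, fun y hy => ?_⟩
  have hyη : y η ≠ p η := by rw [hy (by simp [hη, heη])]; exact hne
  have hyp : ¬ EqOn y p (Iio γ) := fun h' => hyη (h' hη)
  have hle : depth e γ p y ≤ depth e γ p x := heη ▸ depth_le hη hyη
  refine ⟨hyp, hle.antisymm ?_⟩
  obtain ⟨ζ, hζ, hne', heζ⟩ := exists_eq_depth (e := e) hyp
  rw [hy (by simp [hζ, heζ, hle])] at hne'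
  exact heζ ▸ depth_le hζ hne'

theorem Admissible.congr {e : I → ℕ} {γ : I} {v : (I → Bool) × (ℕ → Bool)} {x y : I → Bool}
    (hx : Admissible e γ v x) (h : EqOn x y (Iic γ)) : Admissible e γ v y := by
  have h' := h.mono Iio_subset_Iic_self
  refine hx.imp (fun hp => h'.symm.trans hp) fun hc => ?_
  rw [← h self_mem_Iic, ← depth_congr h', hc]

theorem isClosed_setOf_admissible {e : I → ℕ} {γ : I} (he : InjOn e (Iio γ))
    (v : (I → Bool) × (ℕ → Bool)) : IsClosed {x | Admissible e γ v x} := by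
  refine isOpen_compl_iff.1 (isOpen_iff_mem_nhds.2 fun x hx => ?_)
  obtain ⟨h1, h2⟩ := not_or.1 hx
  obtain ⟨F, -, hF⟩ := exists_finset_depth_eq he h1
  filter_upwards [eventually_eqOn_finset F, eventually_eqOn_finset {γ}] with y hy hyγ
  obtain ⟨h3, h4⟩ := hF y hy
  exact not_or.2 ⟨h3, by rwa [h4, hyγ (by simp)]⟩

/-- Modulo `α`, the point `y` is an accumulation point of the points `b ξ` with `ξ < α`. -/
def IsAcc (b : I → I → Bool) (α : I) (y : I → Bool) : Prop :=
  ∀ F : Finset I, (F : Set I) ⊆ Iio α → ∃ ξ < α, ¬ EqOn (b ξ) y (Iio α) ∧ EqOn (b ξ) y F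

/-- Every neighbourhood of `p` modulo `γ` contains a whole fibre in `S`, over the coordinates
below `α`, of one of the points `b ξ` with `ξ < α` that differ from `p` modulo `α`. -/
def FibresAccumulate (b : I → I → Bool) (α γ : I) (S : Set (I → Bool)) (p : I → Bool) : Prop :=
  ∀ F : Finset I, (F : Set I) ⊆ Iio γ → ∃ ξ < α, ¬ EqOn (b ξ) p (Iio α) ∧
    ∀ x ∈ S, EqOn x (b ξ) (Iio α) → EqOn x p F

/-- The datum `v = (p, c)` is a good choice for stage `γ` with underlying set `S`: the point `p`
lies in `S`, it is an accumulation point of the guessed points `B γ` if `S` has such a point, and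
the fibres over the points guessed at any `α ≤ γ` accumulate at both halves of `p`, provided that
`p` is an accumulation point modulo `α`. -/
def GoodSplit (B : I → I → I → Bool) (e : I → ℕ) (γ : I) (S : Set (I → Bool))
    (v : (I → Bool) × (ℕ → Bool)) : Prop :=
  v.1 ∈ S ∧ ((∃ p ∈ S, IsAcc (B γ) γ p) → IsAcc (B γ) γ v.1) ∧
    ∀ α ≤ γ, IsAcc (B α) α v.1 → ∀ F : Finset I, (F : Set I) ⊆ Iio γ → ∀ i, ∃ ξ < α,
      ¬ EqOn (B α ξ) v.1 (Iio α) ∧ ∀ x ∈ S, EqOn x (B α ξ) (Iio α) →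
        EqOn x v.1 F ∧ v.2 (depth e γ v.1 x) = i

/-- A fibre over a point other than `p` has bounded depth, so the fibres near `p` lie in
bounded intervals of depths, and the colouring lemma applies to these intervals. -/
theorem exists_goodSplit {B : I → I → I → Bool} {e : I → ℕ} {γ : I} {S : Set (I → Bool)}
    (hγ : (Iic γ).Countable) (he : InjOn e (Iio γ)) (hS : S.Nonempty)
    (h : ∀ p ∈ S, ∀ α ≤ γ, IsAcc (B α) α p → FibresAccumulate (B α) α γ S p) :
    ∃ v, GoodSplit B e γ S v := by
  obtain ⟨p, hp, hpacc⟩ : ∃ p ∈ S, (∃ p ∈ S, IsAcc (B γ) γ p) → IsAcc (B γ) γ p := by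
    by_cases hex : ∃ p ∈ S, IsAcc (B γ) γ p
    · obtain ⟨p, hp, hacc⟩ := hex
      exact ⟨p, hp, fun _ => hacc⟩
    · obtain ⟨p, hp⟩ := hS
      exact ⟨p, hp, fun h => absurd h hex⟩
  have : Countable {α // α ≤ γ ∧ IsAcc (B α) α p} :=
    (hγ.mono fun α (hα : α ≤ γ ∧ IsAcc (B α) α p) => hα.1).to_subtype
  obtain ⟨c, hc⟩ := exists_coloring
    (fun (α : {α // α ≤ γ ∧ IsAcc (B α) α p}) n m => ∃ ξ < α.1, ¬ EqOn (B α ξ) p (Iio α.1) ∧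
      ∀ x ∈ S, EqOn x (B α ξ) (Iio α.1) → n ≤ depth e γ p x ∧ depth e γ p x < m)
    (by
      rintro α n m m' hm ⟨ξ, hξ, hne, hx⟩
      exact ⟨ξ, hξ, hne, fun x hxS hxe => (hx x hxS hxe).imp_right fun h => h.trans_le hm⟩)
    (by
      rintro ⟨α, hα, hacc⟩ n
      obtain ⟨ξ, hξ, hne, hx⟩ := h p hp α hα hacc (finite_index_le he n).toFinset
        (fun η hη => by simp_all)
      obtain ⟨η, hη, hηne, -⟩ := exists_eq_depth (e := e) hne
      refine ⟨e η + 1, ξ, hξ, hne, fun x hxS hxe => ?_⟩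
      have hxη : x η ≠ p η := by rwa [hxe hη]
      have hηγ : η < γ := hη.trans_le hα
      refine ⟨not_lt.1 fun hlt => ?_, Nat.lt_succ_of_le (depth_le hηγ hxη)⟩
      obtain ⟨ζ, hζ, hζne, heζ⟩ := exists_eq_depth (e := e) (fun h' => hxη (h' hηγ))
      exact hζne (hx x hxS hxe (by simp [hζ, heζ, hlt.le])))
  refine ⟨(p, c), hp, hpacc, fun α hα hacc F hF i => ?_⟩
  obtain ⟨n, hn⟩ : ∃ n, ∀ η ∈ F, e η < n :=
    ⟨F.sup e + 1, fun η hη => Nat.lt_succ_of_le (Finset.le_sup hη)⟩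
  obtain ⟨a, han, b, ⟨ξ, hξ, hne, hx⟩, hci⟩ := hc ⟨α, hα, hacc⟩ n i
  refine ⟨ξ, hξ, hne, fun x hxS hxe => ?_⟩
  obtain ⟨h1, h2⟩ := hx x hxS hxe
  refine ⟨fun η hη => ?_, hci _ h1 h2⟩
  by_contra hηne
  exact absurd (depth_le (e := e) (hF hη) hηne) (((hn η hη).trans_le (han.trans h1)).not_ge)

/-! ### The inverse limit -/

variable (e : I → I → ℕ) (d : I → (I → Bool) × (ℕ → Bool))

/-- The points which satisfy the restrictions imposed below `γ`. Only their coordinates below `γ`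
are restricted, so this set is the preimage in `I → Bool` of the `γ`-th space of the inverse
system. -/
def stage (γ : I) : Set (I → Bool) := {x | ∀ β < γ, Admissible (e β) β (d β) x}

/-- The limit of the inverse system of the sets `stage e d γ`. -/
def limitSpace : Set (I → Bool) := {x | ∀ β, Admissible (e β) β (d β) x}

variable {e d}

theorem limitSpace_subset_stage (γ : I) : limitSpace e d ⊆ stage e d γ := fun _ hx β _ => hx β

theorem stage_anti {β γ : I} (h : β ≤ γ) : stage e d γ ⊆ stage e d β :=
  fun _ hx δ hδ => hx δ (hδ.trans_le h)

theorem isClosed_limitSpace (he : ∀ γ, InjOn (e γ) (Iio γ)) : IsClosed (limitSpace e d) := by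
  simp only [limitSpace, ofPred_forall]
  exact isClosed_iInter fun β => isClosed_setOf_admissible (he β) _

/-- The values on a set `s` of coordinates can be prescribed, and the other coordinates be chosen
one after the other so that the restrictions at them are satisfied. -/
theorem exists_eqOn_admissible [WellFoundedLT I] (s : Set I) (x₀ : I → Bool) :
    ∃ x, EqOn x x₀ s ∧ ∀ β ∉ s, Admissible (e β) β (d β) x := by
  classical
  let step : (β : I) → ((η : I) → η < β → Bool) → Bool := fun β ih =>
    if β ∈ s then x₀ β else
      (d β).2 (depth (e β) β (d β).1 fun η => if h : η < β then ih η h else false)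
  let x : I → Bool := (wellFounded_lt (α := I)).fix step
  have hx : ∀ β, x β = step β fun η _ => x η := fun β => WellFounded.fix_eq _ _ _
  refine ⟨x, fun β hβ => by rw [hx]; simp [step, hβ], fun β hβ => Or.inr ?_⟩
  rw [hx]
  simp only [step, hβ, if_false]
  exact congrArg (d β).2 (depth_congr fun η (hη : η < β) => by rw [dif_pos hη])

theorem nonempty_limitSpace [WellFoundedLT I] : (limitSpace e d).Nonempty :=
  (exists_eqOn_admissible (e := e) (d := d) ∅ fun _ => false).imp fun _ hx β => hx.2 β (by simp)

/-- Both extensions of the point that is split at stage `γ` extend to points of the limit. -/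
theorem exists_mem_limitSpace [WellFoundedLT I] {γ : I} (hγ : (d γ).1 ∈ stage e d γ) (i : Bool) :
    ∃ x ∈ limitSpace e d, EqOn x (d γ).1 (Iio γ) ∧ x γ = i := by
  classical
  obtain ⟨x, hx, hadm⟩ := exists_eqOn_admissible (e := e) (d := d) (Iic γ)
    (Function.update (d γ).1 γ i)
  have hlt : EqOn x (d γ).1 (Iio γ) := fun η (hη : η < γ) => by
    rw [hx hη.le, Function.update_of_ne hη.ne]
  refine ⟨x, fun β => ?_, hlt, by rw [hx self_mem_Iic, Function.update_self]⟩
  rcases lt_trichotomy β γ with h | rfl | h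
  · exact (hγ β h).congr fun η (hη : η ≤ β) => (hlt (hη.trans_lt h)).symm
  · exact Or.inl hlt
  · exact hadm β h.not_ge

/-- The fibres over the points guessed at `α` accumulate at every point of stage `γ` that is an
accumulation point of them modulo `α`. By induction on `γ`; only a stage `δ < γ` at which the
point is split matters, and there the choice of the datum takes care of both halves. -/
theorem fibresAccumulate_stage [WellFoundedLT I] {B : I → I → I → Bool}
    (he : ∀ γ, InjOn (e γ) (Iio γ)) {α : I} (γ : I) (hαγ : α ≤ γ)
    (hd : ∀ δ < γ, GoodSplit B (e δ) δ (stage e d δ) (d δ)) {y : I → Bool}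
    (hy : y ∈ stage e d γ) (hacc : IsAcc (B α) α y) :
    FibresAccumulate (B α) α γ (stage e d γ) y := by
  classical
  induction γ using WellFoundedLT.induction with
  | ind γ ih =>
  intro F hF
  by_cases hFα : (F : Set I) ⊆ Iio α
  · obtain ⟨ξ, hξ, hne, heq⟩ := hacc F hFα
    exact ⟨ξ, hξ, hne, fun x _ hx η hη => (hx (hFα hη)).trans (heq hη)⟩
  -- the largest coordinate `δ` in `F` is the only one that stage `δ` does not see
  have hFne : F.Nonempty := by
    by_contra h
    exact hFα (by simp [Finset.not_nonempty_iff_eq_empty.1 h])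
  set δ := F.max' hFne with hδ
  have hδF : δ ∈ F := F.max'_mem hFne
  have hδγ : δ < γ := hF hδF
  have hαδ : α ≤ δ := not_lt.1 fun h => hFα fun η hη => (F.le_max' η hη).trans_lt h
  have hFδ : ((F.erase δ : Finset I) : Set I) ⊆ Iio δ := fun η hη => by
    obtain ⟨h1, h2⟩ := Finset.mem_erase.1 (Finset.mem_coe.1 hη)
    exact lt_of_le_of_ne (F.le_max' η h2) h1
  have hglue : ∀ x : I → Bool, EqOn x y (F.erase δ) → x δ = y δ → EqOn x y F :=
    fun x h1 h2 η hη => by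
      by_cases h : η = δ
      · rw [h, h2]
      · exact h1 (Finset.mem_coe.2 (Finset.mem_erase.2 ⟨h, hη⟩))
  have hsub := stage_anti (e := e) (d := d) hδγ.le
  by_cases hyp : EqOn y (d δ).1 (Iio δ)
  · have haccp : IsAcc (B α) α (d δ).1 := fun G hG => by
      obtain ⟨ξ, hξ, hne, heq⟩ := hacc G hG
      have hyα := hyp.mono (Iio_subset_Iio hαδ)
      exact ⟨ξ, hξ, fun h => hne (h.trans hyα.symm), heq.trans (hyα.mono hG)⟩
    obtain ⟨ξ, hξ, hne, hx⟩ := (hd δ hδγ).2.2 α hαδ haccp (F.erase δ) hFδ (y δ)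
    have hyα := hyp.mono (Iio_subset_Iio hαδ)
    refine ⟨ξ, hξ, fun h => hne (h.trans hyα), fun x hxS hxe => ?_⟩
    obtain ⟨h1, h2⟩ := hx x (hsub hxS) hxe
    refine hglue x (h1.trans (hyp.mono hFδ).symm) ?_
    refine (hxS δ hδγ).elim (fun h => ?_) fun h => h.trans h2
    exact absurd (hxe.symm.trans (h.mono (Iio_subset_Iio hαδ))) hne
  · obtain ⟨G, hG, hdepth⟩ := exists_finset_depth_eq (he δ) hyp
    obtain ⟨ξ, hξ, hne, hx⟩ := ih δ hδγ hαδ (fun ε hε => hd ε (hε.trans hδγ)) (hsub hy)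
      (F.erase δ ∪ G) (by simp only [Finset.coe_union]; exact union_subset hFδ hG)
    refine ⟨ξ, hξ, hne, fun x hxS hxe => ?_⟩
    have hxFG := hx x (hsub hxS) hxe
    rw [Finset.coe_union] at hxFG
    obtain ⟨h1, h2⟩ := hdepth x (hxFG.mono subset_union_right)
    refine hglue x (hxFG.mono subset_union_left) ?_
    rw [(hxS δ hδγ).resolve_left h1, (hy δ hδγ).resolve_left hyp, h2]

theorem exists_goodSplits [WellFoundedLT I] (hI : ∀ a : I, (Iic a).Countable)
    (he : ∀ γ, InjOn (e γ) (Iio γ)) (B : I → I → I → Bool) :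
    ∃ d, ∀ γ, GoodSplit B (e γ) γ (stage e d γ) (d γ) := by
  classical
  let step : (γ : I) → ((β : I) → β < γ → (I → Bool) × (ℕ → Bool)) → (I → Bool) × (ℕ → Bool) :=
    fun γ ih => Classical.epsilon
      (GoodSplit B (e γ) γ {x | ∀ β (h : β < γ), Admissible (e β) β (ih β h) x})
  let d : I → (I → Bool) × (ℕ → Bool) := (wellFounded_lt (α := I)).fix step
  have hd : ∀ γ, d γ = Classical.epsilon (GoodSplit B (e γ) γ (stage e d γ)) :=
    fun γ => WellFounded.fix_eq _ _ _
  refine ⟨d, fun γ => ?_⟩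
  induction γ using WellFoundedLT.induction with
  | ind γ ih =>
  rw [hd γ]
  exact Classical.epsilon_spec (exists_goodSplit (hI γ) (he γ)
    (nonempty_limitSpace.mono (limitSpace_subset_stage γ))
    fun p hp α hα hacc => fibresAccumulate_stage he γ hα ih hp hacc)

end Construction

/-! ### The properties of the limit space -/

theorem exists_finset_of_mem_nhds {I : Type*} {x : I → Bool} {U : Set (I → Bool)} (hU : U ∈ 𝓝 x) :
    ∃ F : Finset I, ∀ y, EqOn y x F → y ∈ U := by
  obtain ⟨V, hVU, hV, hxV⟩ := mem_nhds_iff.1 hU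
  obtain ⟨F, u, hu, hFu⟩ := isOpen_pi_iff.1 hV x hxV
  exact ⟨F, fun y hy => hVU (hFu fun η hη => by rw [hy hη]; exact (hu η hη).2)⟩

section Limit

variable {I : Type*} [LinearOrder I]
variable {e : I → I → ℕ} {d : I → (I → Bool) × (ℕ → Bool)} {B : I → I → I → Bool}

theorem infinite_limitSpace [WellFoundedLT I] [Infinite I]
    (hd : ∀ γ, GoodSplit B (e γ) γ (stage e d γ) (d γ)) : (limitSpace e d).Infinite := by
  intro hfin
  have := hfin.to_subtype
  choose x hx hlt hval using fun γ => exists_mem_limitSpace (hd γ).1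
  -- the two extensions of the point split at `γ` differ for the first time at `γ`,
  -- so they determine `γ`
  refine not_injective_infinite_finite
    (fun γ => ((⟨x γ false, hx γ false⟩, ⟨x γ true, hx γ true⟩) :
      limitSpace e d × limitSpace e d)) fun γ δ h => ?_
  simp only [Prod.mk.injEq, Subtype.mk.injEq] at h
  by_contra hne
  wlog hγδ : γ < δ generalizing γ δ
  · exact this δ γ ⟨h.1.symm, h.2.symm⟩ (Ne.symm hne)
      (lt_of_le_of_ne (not_lt.1 hγδ) (Ne.symm hne))
  have h1 := (hlt δ false hγδ).trans (hlt δ true hγδ).symm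
  rw [← h.1, ← h.2, hval, hval] at h1
  exact Bool.false_ne_true h1

theorem fibresAccumulate_limitSpace [WellFoundedLT I] [Uncountable I]
    (hI : ∀ a : I, (Iic a).Countable) (he : ∀ γ, InjOn (e γ) (Iio γ))
    (hd : ∀ γ, GoodSplit B (e γ) γ (stage e d γ) (d γ)) {α : I} {y : I → Bool}
    (hy : y ∈ limitSpace e d) (hacc : IsAcc (B α) α y) (F : Finset I) :
    ∃ ξ < α, ∀ x ∈ limitSpace e d, EqOn x (B α ξ) (Iio α) → EqOn x y F := by
  obtain ⟨γ, hγ⟩ := exists_strictUpperBound_of_countable hI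
    (F.countable_toSet.union (countable_singleton α))
  obtain ⟨ξ, hξ, -, hx⟩ := fibresAccumulate_stage he γ (hγ α (Or.inr rfl)).le (fun δ _ => hd δ)
    (limitSpace_subset_stage γ hy) hacc F fun η hη => hγ η (Or.inl hη)
  exact ⟨ξ, hξ, fun x hxS => hx x (limitSpace_subset_stage γ hxS)⟩

/-- A convergent sequence that is not eventually constant is guessed at some `α`. Its limit is the
only accumulation point modulo `α`, hence is the point split at `α`, and so the coordinate `α` of
the members of the sequence takes both values infinitely often. -/
theorem noNontrivialConvergentSeq_limitSpace [WellFoundedLT I] [Uncountable I]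
    (hI : ∀ a : I, (Iic a).Countable) (hB : Guesses B)
    (hd : ∀ γ, GoodSplit B (e γ) γ (stage e d γ) (d γ)) :
    NoNontrivialConvergentSeq (limitSpace e d) := by
  classical
  intro s x hs
  by_contra hne
  rw [not_eventually] at hne
  have hs' : Tendsto (fun n => (s n : I → Bool)) atTop (𝓝 x) :=
    (continuous_subtype_val.tendsto x).comp hs
  have hev : ∀ F : Finset I, ∀ᶠ n in atTop, EqOn (s n : I → Bool) x F := fun F =>
    hs'.eventually (eventually_eqOn_finset F)
  -- the members of the sequence are indexed by ordinals through a left inverse `k` of `j`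
  obtain ⟨j⟩ : Nonempty (ℕ ↪ I) := ⟨Infinite.natEmbedding I⟩
  have hk := Function.leftInverse_invFun j.injective
  set k := Function.invFun j
  have hdiff : ∀ n, ∃ η, s n ≠ x → (s n : I → Bool) η ≠ (x : I → Bool) η := fun n => by
    by_cases h : s n = x
    · exact ⟨j 0, fun h' => absurd h h'⟩
    · obtain ⟨η, hη⟩ := Function.ne_iff.1 (fun h' => h (Subtype.ext h'))
      exact ⟨η, fun _ => hη⟩
  choose δ hδ using hdiff
  obtain ⟨a₀, ha₀⟩ := exists_strictUpperBound_of_countable hI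
    ((countable_range j).union (countable_range δ))
  obtain ⟨α, hα₀, -, hα⟩ := hB (fun ξ => s (k ξ)) id a₀
  have hguess : ∀ ξ < α, EqOn (B α ξ) (s (k ξ)) (Iio α) := fun ξ hξ η hη => hα ξ hξ η hη
  have hjα : ∀ n, j n < α := fun n => (ha₀ _ (Or.inl ⟨n, rfl⟩)).trans hα₀
  have hδα : ∀ n, δ n < α := fun n => (ha₀ _ (Or.inr ⟨n, rfl⟩)).trans hα₀
  have hacc : IsAcc (B α) α x := fun F hF => by
    obtain ⟨n, hn, hnF⟩ := (hne.and_eventually (hev F)).exists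
    have hg := hguess _ (hjα n)
    rw [hk n] at hg
    exact ⟨j n, hjα n, fun h => hδ n hn ((hg (hδα n)).symm.trans (h (hδα n))),
      (hg.mono hF).trans hnF⟩
  obtain ⟨-, hp, hsplit⟩ := hd α
  replace hp := hp ⟨x, limitSpace_subset_stage α x.2, hacc⟩
  set p := (d α).1 with hpdef
  -- neighbourhoods of `p` avoid any given finite part of the sequence
  have havoid : ∀ N : ℕ, ∃ F : Finset I, (F : Set I) ⊆ Iio α ∧ ∀ n,
      ¬ EqOn (s n : I → Bool) p (Iio α) → EqOn (s n : I → Bool) p F → N ≤ n := fun N => by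
    have hη : ∀ n, ∃ η < α, ¬ EqOn (s n : I → Bool) p (Iio α) → (s n : I → Bool) η ≠ p η :=
      fun n => by
        by_cases h : EqOn (s n : I → Bool) p (Iio α)
        · exact ⟨j 0, hjα 0, fun h' => absurd h h'⟩
        · simp only [EqOn, not_forall] at h
          obtain ⟨η, h1, h2⟩ := h
          exact ⟨η, h1, fun _ => h2⟩
    choose ε hεα hε using hη
    refine ⟨(Finset.range N).image ε, fun η hη => ?_, fun n hn hF => not_lt.1 fun hlt => ?_⟩
    · obtain ⟨n, -, rfl⟩ := Finset.mem_image.1 hη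
      exact hεα n
    · exact hε n hn (hF (Finset.mem_coe.2 (Finset.mem_image_of_mem ε (Finset.mem_range.2 hlt))))
  have hpx : EqOn (x : I → Bool) p (Iio α) := by
    intro η hη
    obtain ⟨N, hN⟩ := eventually_atTop.1 (hev {η})
    obtain ⟨F, hF, hFN⟩ := havoid N
    obtain ⟨ξ, hξ, hξne, hξF⟩ := hp (insert η F) (by
      rw [Finset.coe_insert]; exact insert_subset hη hF)
    have hg := hguess ξ hξ
    rw [Finset.coe_insert] at hξF
    have hsF : EqOn (s (k ξ) : I → Bool) p (insert η F) :=
      (hg.symm.mono (insert_subset hη hF)).trans hξF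
    have hge := hFN (k ξ) (fun h => hξne (hg.trans h)) (hsF.mono (subset_insert _ _))
    exact (hN _ hge (by simp)).symm.trans (hsF (mem_insert _ _))
  -- some late member of the sequence has the value at `α` that the limit does not have
  obtain ⟨N, hN⟩ := eventually_atTop.1 (hev {α})
  obtain ⟨F, hF, hFN⟩ := havoid N
  obtain ⟨ξ, hξ, hξne, hx⟩ := hsplit α le_rfl hp F hF (!(x : I → Bool) α)
  have hg := hguess ξ hξ
  obtain ⟨hsF, hcol⟩ := hx _ (limitSpace_subset_stage α (s (k ξ)).2) hg.symm
  have hsp : ¬ EqOn (s (k ξ) : I → Bool) p (Iio α) := fun h => hξne (hg.trans h)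
  have hval := ((s (k ξ)).2 α).resolve_left hsp
  rw [hcol, hN _ (hFN _ hsp hsF) (by simp)] at hval
  simp at hval

/-- In a sequence `x` that is indexed by the countable ordinals and injective, `x α` is, for all
large closure points `α` of a suitable function, an accumulation point modulo `α` of the earlier
members of the sequence. -/
theorem exists_closure_function [Uncountable I] (hI : ∀ a : I, (Iic a).Countable)
    {x : I → I → Bool} (hx : Function.Injective x) : ∃ g : I → I, ∀ a₀ α, a₀ < α →
      (∀ β < α, g β < α) → ∀ F : Finset I, (F : Set I) ⊆ Iio α →
        ∃ ξ < α, ¬ EqOn (x ξ) (x α) (Iio α) ∧ EqOn (x ξ) (x α) F := by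
  classical
  -- a basic open set is given by finite sets `G ⊆ F` of coordinates: the coordinates in `G` have
  -- the value `true`, the others in `F` the value `false`
  let U : Finset I × Finset I → Set I := fun q => {ξ | ∀ η ∈ q.1, x ξ η = decide (η ∈ q.2)}
  have hξ : ∀ q, ∃ ξ, (U q).Nonempty → ξ ∈ U q := fun q => by
    rcases (U q).eq_empty_or_nonempty with h | ⟨ξ, hξ⟩
    · exact ⟨Classical.arbitrary I, fun h' => absurd h h'.ne_empty⟩
    · exact ⟨ξ, fun _ => hξ⟩
  choose a ha using hξ
  have hξ' : ∀ q, ∃ r : I × I × I, (U q).Nontrivial →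
      r.1 ∈ U q ∧ r.2.1 ∈ U q ∧ x r.1 r.2.2 ≠ x r.2.1 r.2.2 := fun q => by
    by_cases h : (U q).Nontrivial
    · obtain ⟨ξ, h1, ζ, h2, hne⟩ := h
      obtain ⟨η, hη⟩ := Function.ne_iff.1 (hx.ne hne)
      exact ⟨(ξ, ζ, η), fun _ => ⟨h1, h2, hη⟩⟩
    · exact ⟨Classical.arbitrary _, fun h' => absurd h' h⟩
  choose r hr using hξ'
  have hfin : ∀ β, {F : Finset I | (F : Set I) ⊆ Iic β}.Countable := fun β =>
    ((countable_ofPred_finite_subset (hI β)).preimage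
      (f := fun F : Finset I => (F : Set I)) Finset.coe_injective).mono
      fun F hF => And.intro F.finite_toSet hF
  have hg : ∀ β, ∃ γ, ∀ q : Finset I × Finset I, (q.1 : Set I) ⊆ Iic β → (q.2 : Set I) ⊆ Iic β →
      a q < γ ∧ (r q).1 < γ ∧ (r q).2.1 < γ ∧ (r q).2.2 < γ := fun β => by
    have hc : {q : Finset I × Finset I | (q.1 : Set I) ⊆ Iic β ∧ (q.2 : Set I) ⊆ Iic β}.Countable :=
      (hfin β).prod (hfin β)
    obtain ⟨γ, hγ⟩ := exists_strictUpperBound_of_countable hI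
      ((hc.image a).union ((hc.image fun q => (r q).1).union
        ((hc.image fun q => (r q).2.1).union (hc.image fun q => (r q).2.2))))
    exact ⟨γ, fun q h1 h2 => ⟨hγ _ (Or.inl ⟨q, ⟨h1, h2⟩, rfl⟩),
      hγ _ (Or.inr (Or.inl ⟨q, ⟨h1, h2⟩, rfl⟩)),
      hγ _ (Or.inr (Or.inr (Or.inl ⟨q, ⟨h1, h2⟩, rfl⟩))),
      hγ _ (Or.inr (Or.inr (Or.inr ⟨q, ⟨h1, h2⟩, rfl⟩)))⟩⟩
  choose g hg using hg
  refine ⟨g, fun a₀ α hα₀ hα F hF => ?_⟩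
  let q : Finset I × Finset I := (F, F.filter fun η => x α η = true)
  obtain ⟨β, hβα, hβ⟩ : ∃ β < α, (F : Set I) ⊆ Iic β := by
    rcases F.eq_empty_or_nonempty with rfl | hne
    · exact ⟨a₀, hα₀, by simp⟩
    · exact ⟨F.max' hne, hF (F.max'_mem hne), fun η hη => F.le_max' η hη⟩
  obtain ⟨h1, h2, h3, h4⟩ := hg β q hβ fun η hη => hβ (Finset.mem_of_mem_filter η hη)
  have hgα := hα β hβα
  have hU : ∀ ξ, ξ ∈ U q ↔ EqOn (x ξ) (x α) F := fun ξ => by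
    refine forall₂_congr fun η hη => ?_
    have : decide (η ∈ F.filter fun η => x α η = true) = x α η := by
      simp [Finset.mem_filter, show η ∈ F from hη]
    rw [this]
  have hαU : α ∈ U q := (hU α).2 fun _ _ => rfl
  have haU := ha q ⟨α, hαU⟩
  -- since `x α` is not among the earlier members, its neighbourhood contains two members and hence
  -- two members that differ modulo `α`
  obtain ⟨hr1, hr2, hr3⟩ := hr q ⟨_, haU, α, hαU, (h1.trans hgα).ne⟩
  by_cases h : EqOn (x (r q).1) (x α) (Iio α)
  · refine ⟨_, h3.trans hgα, fun h' => hr3 ?_, (hU _).1 hr2⟩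
    exact (h (h4.trans hgα)).trans (h' (h4.trans hgα)).symm
  · exact ⟨_, h2.trans hgα, h, (hU _).1 hr1⟩

/-- A subset that is not separable contains a left-separated sequence of length `ω₁`. -/
theorem exists_leftSeparated [WellFoundedLT I] (hI : ∀ a : I, (Iic a).Countable) {X : Type*}
    [TopologicalSpace X] (hX : ¬ TopologicalSpace.SeparableSpace X) :
    ∃ x : I → X, ∀ ξ, x ξ ∉ closure (x '' Iio ξ) := by
  have : Nonempty X := by
    by_contra h
    rw [not_nonempty_iff] at h
    exact hX inferInstance
  have hnext : ∀ s : Set X, ∃ y, s.Countable → y ∉ closure s := fun s => by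
    by_contra! h
    exact hX ⟨s, (h (Classical.arbitrary X)).1, fun y => (h y).2⟩
  choose next hnext using hnext
  let step : (ξ : I) → ((η : I) → η < ξ → X) → X := fun ξ ih =>
    next (range fun η : Iio ξ => ih η η.2)
  let x : I → X := (wellFounded_lt (α := I)).fix step
  have hx : ∀ ξ, x ξ = next (x '' Iio ξ) := fun ξ => by
    rw [image_eq_range]
    exact WellFounded.fix_eq _ _ _
  refine ⟨x, fun ξ => ?_⟩
  rw [hx ξ]
  exact hnext _ (((hI ξ).mono Iio_subset_Iic_self).image x)

/-- A left-separated sequence is guessed at some `α` at which its member with index `α` is an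
accumulation point modulo `α` of the earlier members. By the preservation of accumulation, this
member is then in the closure of the earlier ones. -/
theorem hereditarilySeparable_limitSpace [WellFoundedLT I] [Uncountable I]
    (hI : ∀ a : I, (Iic a).Countable) (he : ∀ γ, InjOn (e γ) (Iio γ)) (hB : Guesses B)
    (hd : ∀ γ, GoodSplit B (e γ) γ (stage e d γ) (d γ)) :
    HereditarilySeparable (limitSpace e d) := by
  intro Y
  by_contra hY
  obtain ⟨x, hx⟩ := exists_leftSeparated hI hY
  have hinj : Function.Injective x := fun ξ ζ h => by
    by_contra hne
    wlog hlt : ξ < ζ generalizing ξ ζ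
    · exact this ζ ξ h.symm (Ne.symm hne) (lt_of_le_of_ne (not_lt.1 hlt) (Ne.symm hne))
    exact hx ζ (subset_closure ⟨ξ, hlt, h⟩)
  let z : I → I → Bool := fun ξ => (x ξ : limitSpace e d)
  have hz : Function.Injective z :=
    Subtype.val_injective.comp (Subtype.val_injective.comp hinj)
  obtain ⟨g, hg⟩ := exists_closure_function hI hz
  obtain ⟨α, hα₀, hαg, hα⟩ := hB z g (Classical.arbitrary I)
  have hguess : ∀ ξ < α, EqOn (B α ξ) (z ξ) (Iio α) := fun ξ hξ η hη => hα ξ hξ η hη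
  have hacc : IsAcc (B α) α (z α) := fun F hF => by
    obtain ⟨ξ, hξ, h1, h2⟩ := hg _ α hα₀ hαg F hF
    exact ⟨ξ, hξ, fun h => h1 ((hguess ξ hξ).symm.trans h), ((hguess ξ hξ).mono hF).trans h2⟩
  refine hx α (mem_closure_iff_nhds.2 fun U hU => ?_)
  have hind : IsInducing fun y : Y => ((y : limitSpace e d) : I → Bool) :=
    IsInducing.subtypeVal.comp IsInducing.subtypeVal
  rw [hind.nhds_eq_comap] at hU
  obtain ⟨V, hV, hVU⟩ := hU
  obtain ⟨F, hF⟩ := exists_finset_of_mem_nhds hV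
  obtain ⟨ξ, hξ, hfib⟩ := fibresAccumulate_limitSpace hI he hd (x α).1.2 hacc F
  exact ⟨x ξ, hVU (hF _ (hfib _ (x ξ).1.2 (hguess ξ hξ).symm)), ξ, hξ, rfl⟩

end Limit

/-! ### Fedorchuk's space under diamond -/

theorem IsFedorchukSpace.of_homeomorph {X : Type*} {Y : Type*} [TopologicalSpace X]
    [TopologicalSpace Y] (h : IsFedorchukSpace X) (f : X ≃ₜ Y) : IsFedorchukSpace Y where
  infinite := have := h.infinite; f.toEquiv.infinite_iff.1 this
  compact := have := h.compact; f.compactSpace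
  hausdorff := have := h.hausdorff; f.t2Space
  hereditarilySeparable S := by
    have := h.hereditarilySeparable (f ⁻¹' S)
    exact (f.sets (s := f ⁻¹' S) rfl).surjective.denseRange.separableSpace
      (f.sets (s := f ⁻¹' S) rfl).continuous
  noConvergentSeq s x hs := by
    refine (h.noConvergentSeq (f.symm ∘ s) (f.symm x)
      ((f.symm.continuous.tendsto x).comp hs)).mono fun n hn => f.symm.injective hn

/-- The index set is moved from `Omega1`, which lives in `Type 1`, to the lowest universe. -/
theorem Diamond.exists_isFedorchukSpace (h : Diamond) :
    ∃ (X : Type u) (_ : TopologicalSpace X), IsFedorchukSpace X := by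
  classical
  obtain ⟨B, hB⟩ := h.exists_guesses
  let I := (Ordinal.omega.{0} 1).ToType
  let m : Omega1 ≃o I := Ordinal.ToType.mk
  have hI : ∀ a : I, (Iic a).Countable := fun a => by
    refine ((countable_Iic_omega1 (m.symm a)).image m).mono fun b hb => ?_
    exact ⟨m.symm b, m.symm.monotone hb, m.apply_symm_apply b⟩
  have : Uncountable I := m.toEquiv.uncountable_iff.1 inferInstance
  have hB' : Guesses fun α ξ η : I => B (m.symm α) (m.symm ξ) (m.symm η) := fun f g a₀ => by
    obtain ⟨α, h1, h2, h3⟩ := hB (fun ξ η => f (m ξ) (m η)) (fun ξ => m.symm (g (m ξ))) (m.symm a₀)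
    refine ⟨m α, m.symm_apply_lt.1 h1, fun β hβ => ?_, fun ξ hξ η hη => ?_⟩
    · have := h2 (m.symm β) (m.symm_apply_lt.2 hβ)
      rwa [m.apply_symm_apply, m.symm_apply_lt] at this
    · have := h3 _ (m.symm_apply_lt.2 hξ) _ (m.symm_apply_lt.2 hη)
      simpa using this
  have he : ∀ γ : I, ∃ e : I → ℕ, InjOn e (Iio γ) := fun γ =>
    countable_iff_exists_injOn.1 ((hI γ).mono Iio_subset_Iic_self)
  choose e he using he
  obtain ⟨d, hd⟩ := exists_goodSplits hI he _
  have hK : IsFedorchukSpace (limitSpace e d) :=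
    { infinite := (infinite_limitSpace hd).to_subtype
      compact := isCompact_iff_compactSpace.1 (isClosed_limitSpace he).isCompact
      hausdorff := inferInstance
      hereditarilySeparable := hereditarilySeparable_limitSpace hI he hB' hd
      noConvergentSeq := noNontrivialConvergentSeq_limitSpace hI hB' hd }
  exact ⟨ULift.{u} (limitSpace e d), inferInstance, hK.of_homeomorph Homeomorph.ulift.symm⟩

end GBWSpace

theorem mainTheorem8 :
    -- a countably compact space in GBW is sequentially compact
    (∀ (X : Type u) [TopologicalSpace X],
      CountablyCompactSpace X → GBWSpace.GBW X → SeqCompactSpace X) ∧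
    -- a space with the properties of Fedorchuk's space is not in GBW,
    -- although all its discrete subspaces are countable
    (∀ (X : Type u) [TopologicalSpace X], GBWSpace.IsFedorchukSpace X →
      ¬ SeqCompactSpace X ∧ ¬ GBWSpace.GBW X ∧ ∀ D : Set X, IsDiscrete D → D.Countable) ∧
    -- under diamond there is such a space, so it is not true that every space outside GBW has a
    -- discrete subspace whose size is at least the splitting number
    (GBWSpace.Diamond →
      (∃ (X : Type u) (_ : TopologicalSpace X),
        GBWSpace.IsFedorchukSpace X ∧ ¬ GBWSpace.GBW X) ∧
      ¬ ∀ (X : Type u) [TopologicalSpace X], ¬ GBWSpace.GBW X →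
          ∃ D : Set X, IsDiscrete D ∧
            Cardinal.lift.{u} GBWSpace.splittingNumber ≤ Cardinal.mk D) := by
  refine ⟨fun X _ _ h => h.seqCompactSpace, fun X _ h => ⟨h.not_seqCompactSpace, h.not_GBW,
    fun D hD => h.hereditarilySeparable.countable_of_isDiscrete hD⟩, fun hdia => ?_⟩
  obtain ⟨X, _, hX⟩ := hdia.exists_isFedorchukSpace
  refine ⟨⟨X, _, hX, hX.not_GBW⟩, fun hall => ?_⟩
  obtain ⟨D, hD, hcard⟩ := hall X hX.not_GBW
  have hDc := Cardinal.le_aleph0_iff_set_countable.2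
    (hX.hereditarilySeparable.countable_of_isDiscrete hD)
  exact (Cardinal.aleph0_lt_lift.2 GBWSpace.aleph0_lt_splittingNumber).not_ge (hcard.trans hDc)
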